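/- Let $m,p,s,N\ge 1$ be integers with $m\le p$ and $s\le p$, and let $\sigma>0$. Let $x$ be a zero-mean random vector in $\mathbb{R}^p$ with finite second moments and known law, whose support $\operatorname{supp}(x)=\{i: x_i\neq 0\}$ is uniformly distributed over the $\binom{p}{s}$ subsets $\mathcal{S}\subseteq\{1,\dots,p\}$ of size $s$, and whose non-zero entries satisfy $\mathrm{E}\{x_{\mathcal{S}}x_{\mathcal{S}}^T \mid \operatorname{supp}(x)=\mathcal{S}\}=\sigma_a^2 I_s$ for each such $\mathcal{S}$. Let $n\sim\mathcal{N}(0,\sigma^2 I_m)$ be independent of $x$. For a matrix $D\in\mathbb{R}^{m\times p}$ let $Y=(y_1,\dots,y_N)$ consist of $N$ i.i.d. copies of $y=Dx+n$. Let $\mathcal{D}$ be the set of the matrices in $\mathbb{R}^{m\times p}$ whose columns all have unit Euclidean norm; for $D_0\in\mathcal{D}$ and $0<r\le 2\sqrt{p}$ put $\mathcal{X}(D_0,r)=\{D'\in\mathcal{D}:\|D'-D_0\|_F<r\}$ and define the minimax risk $$\varepsilon^*=\inf_{\widehat D}\ \sup_{D'\in\mathcal{X}(D_0,r)}\mathrm{E}_{Y}\{\|\widehat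 D(Y)-D'\|_F^2\},$$ where the data $Y$ in the expectation are generated with $D'$ and the infimum is over all measurable estimators $\widehat D:\mathbb{R}^{m\times N}\to\mathbb{R}^{m\times p}$. Let the true dictionary $D\in\mathcal{X}(D_0,r)$ satisfy the restricted isometry property of order $s$ with a constant $\delta_s\le 1/2$, that is, $(1-\delta_s)\|z\|^2\le\|Dz\|^2\le(1+\delta_s)\|z\|^2$ for all $z\in\mathbb{R}^p$ with at most $s$ non-zero entries, and let $\mathrm{SNR}=\mathrm{E}\{\|Dx\|_2^2\}/\mathrm{E}\{\|n\|_2^2\}$. If $p(m-1)\ge 50$, then $\mathrm{E}\{xx^T\}=(s/p)\sigma_a^2 I_p$ and $$\varepsilon^*\ \ge\ \frac{1}{320}\min\Big\{r^2,\ \frac{2p}{\mathrm{SNR}\cdot N\cdot m}\Big(\frac{p(m-1)}{10}-1\Big)\Big\}.$$ -/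

import Mathlib

open MeasureTheory ProbabilityTheory
open scoped ENNReal NNReal

noncomputable section

namespace DictLearning

open scoped Matrix.Norms.Frobenius

variable {m p : ℕ}

/-- Squared Euclidean norm `‖v‖₂²`. -/
def sqNorm {n : ℕ} (v : Fin n → ℝ) : ℝ := ∑ i, v i ^ 2

/-- The support of a vector. -/
def supp {n : ℕ} (v : Fin n → ℝ) : Finset (Fin n) := {i | v i ≠ 0}

/-- The oblique manifold: `m × p` matrices whose columns have unit Euclidean norm. -/
def dictionaries (m p : ℕ) : Set (Matrix (Fin m) (Fin p) ℝ) :=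
  {B | ∀ k, (B.transpose * B) k k = 1}

/-- `𝒳(D₀, r)`: the dictionaries at Frobenius distance less than `r` from `D₀`. -/
def neighborhood (D₀ : Matrix (Fin m) (Fin p) ℝ) (r : ℝ) : Set (Matrix (Fin m) (Fin p) ℝ) :=
  {D | D ∈ dictionaries m p ∧ ‖D - D₀‖ < r}

/-- `D` satisfies the restricted isometry property of order `s` with constant `δ`. -/
def HasRIP (D : Matrix (Fin m) (Fin p) ℝ) (s : ℕ) (δ : ℝ) : Prop :=
  ∀ z : Fin p → ℝ, (supp z).card ≤ s →
    (1 - δ) * sqNorm z ≤ sqNorm (D.mulVec z) ∧ sqNorm (D.mulVec z) ≤ (1 + δ) * sqNorm z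

/-- `μx` is the law of a zero-mean random vector with finite second moments, whose support is
uniformly distributed over the `s`-element subsets of the index set and whose non-zero entries
have, given that the support is `S`, the second moment matrix `σa² I`. -/
structure IsSparseCoeffLaw (s : ℕ) (σa : ℝ) (μx : Measure (Fin p → ℝ)) : Prop where
  memLp_two : ∀ i, MemLp (fun x : Fin p → ℝ => x i) 2 μx
  mean_zero : ∀ i, ∫ x, x i ∂μx = 0
  supp_uniform : ∀ S : Finset (Fin p), S.card = s →
    μx.real {x | supp x = S} = 1 / (p.choose s : ℝ)
  cond_cov : ∀ S : Finset (Fin p), S.card = s → ∀ i ∈ S, ∀ j ∈ S,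
    ∫ x, x i * x j ∂(μx[|{x | supp x = S}]) = if i = j then σa ^ 2 else 0

/-- The law of white Gaussian noise in `ℝᵐ` with variance `σ²` per component. -/
def noiseLaw (m : ℕ) (σ : ℝ≥0) : Measure (Fin m → ℝ) :=
  Measure.pi fun _ => gaussianReal 0 (σ ^ 2)

/-- The law of one observation `y = D x + n`, with `x ∼ μx` and `n` independent. -/
def obsLaw (μx : Measure (Fin p → ℝ)) (σ : ℝ≥0) (D : Matrix (Fin m) (Fin p) ℝ) :
    Measure (Fin m → ℝ) :=
  (μx.prod (noiseLaw m σ)).map fun xn => D.mulVec xn.1 + xn.2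

/-- The law of the data `Y = (y₁, …, y_N)`, which consists of `N` i.i.d. observations. -/
def dataLaw (μx : Measure (Fin p → ℝ)) (σ : ℝ≥0) (N : ℕ) (D : Matrix (Fin m) (Fin p) ℝ) :
    Measure (Fin N → Fin m → ℝ) :=
  Measure.pi fun _ => obsLaw μx σ D

/-- The mean squared error (in Frobenius norm) of the estimator `Dhat` when the true
dictionary is `D`. -/
def mse (μx : Measure (Fin p → ℝ)) (σ : ℝ≥0) (N : ℕ)
    (Dhat : (Fin N → Fin m → ℝ) → Matrix (Fin m) (Fin p) ℝ) (D : Matrix (Fin m) (Fin p) ℝ) :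
    ℝ≥0∞ :=
  ∫⁻ Y, ENNReal.ofReal (‖Dhat Y - D‖ ^ 2) ∂(dataLaw μx σ N D)

/-- The minimax risk: infimum over all (measurable) estimators of the worst-case mean squared
error over the neighborhood of `D₀`. -/
def minimaxRisk (μx : Measure (Fin p → ℝ)) (σ : ℝ≥0) (N : ℕ)
    (D₀ : Matrix (Fin m) (Fin p) ℝ) (r : ℝ) : ℝ≥0∞ :=
  ⨅ (Dhat : (Fin N → Fin m → ℝ) → Matrix (Fin m) (Fin p) ℝ)
    (_ : ∀ i j, Measurable fun Y => Dhat Y i j),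
    ⨆ D ∈ neighborhood D₀ r, mse μx σ N Dhat D

/-- The signal-to-noise ratio `E ‖D x‖² / E ‖n‖²`. -/
def SNR (μx : Measure (Fin p → ℝ)) (σ : ℝ≥0) (D : Matrix (Fin m) (Fin p) ℝ) : ℝ :=
  (∫ x, sqNorm (D.mulVec x) ∂μx) / ∫ n, sqNorm n ∂(noiseLaw m σ)

end DictLearning

end

/-! The bound is Assouad's. In an orthonormal basis whose first vector is a given column of `D₀`,
give each of the other `n = m - 1` coordinates the value `±ε` and shrink the first one to keep unit
length. The sign patterns `τ` index `2 ^ (p n)` dictionaries, all inside the neighborhood when `ε`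
is small. An estimator with small risk would have to recover every sign.

One sign is hard to recover by a two-point argument. Two dictionaries that differ in one sign are at
squared distance `4 ε ^ 2`, and the quadratic risk of guessing the sign is controlled from below by
the Hellinger affinity of the two data laws (`two_point_bound`). The law of `y` alone is an
intractable mixture, so affinity is computed for the pairs `(x, y)`: revealing `x` can only help the
estimator, and given `x` everything is Gaussian. The affinity is then the mean of `exp (-‖(D - D')
x‖² / (8 σ²))`, which is at least one minus the mean of the exponent; the second moments `(s / p)
σa² I` evaluate it (`le_affinity_jointDensity`). It becomes an `N`-th power for `N` samples and
stays above `3 / 4` while `ε ^ 2` is at most a constant times `σ² p / (N s σa²)`. Summing over the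
`p n` signs and averaging over the cube gives risk at least `p n ε ^ 2 / 2` (`le_minimaxRisk`); `ε`
is then taken as large as allowed, up to constants. -/

noncomputable section

namespace DictLearning

/-! ### Hellinger affinity and the two-point risk bound -/

section Affinity

variable {α : Type*} [MeasurableSpace α]

/-- **Fubini's theorem** for the lower integral of a product of functions of one coordinate. -/
theorem lintegral_fin_prod_eq_prod {n : ℕ} (μ : Measure α) [SigmaFinite μ]
    (f : Fin n → α → ℝ≥0∞) (hf : ∀ i, Measurable (f i)) :
    ∫⁻ x, ∏ i, f i (x i) ∂(Measure.pi fun _ => μ) = ∏ i, ∫⁻ x, f i x ∂μ := by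
  induction n with
  | zero => simp
  | succ n ih =>
    have h := (measurePreserving_piFinSuccAbove (fun _ : Fin (n + 1) => μ) 0).symm
    rw [← h.lintegral_comp (by fun_prop)]
    simp only [Fin.prod_univ_succ, MeasurableEquiv.piFinSuccAbove_symm_apply,
      Fin.insertNthEquiv_zero, Fin.consEquiv_apply, Fin.cons_zero, Fin.cons_succ]
    rw [lintegral_prod_mul (f := f 0) (g := fun y : Fin n → α => ∏ i, f i.succ (y i))
      (hf 0).aemeasurable
      (Finset.measurable_prod _ fun i _ => (hf _).comp (measurable_pi_apply i)).aemeasurable]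
    rw [ih (fun i => f i.succ) fun i => hf _]

theorem pi_withDensity {n : ℕ} (μ : Measure α) [SigmaFinite μ]
    (f : Fin n → α → ℝ≥0∞) (hf : ∀ i, Measurable (f i))
    [∀ i, SigmaFinite (μ.withDensity (f i))] :
    (Measure.pi fun i => μ.withDensity (f i)) =
      (Measure.pi fun _ => μ).withDensity fun x => ∏ i, f i (x i) := by
  refine Measure.pi_eq fun s hs => ?_
  rw [withDensity_apply _ (MeasurableSet.univ_pi hs), ← lintegral_indicator
    (MeasurableSet.univ_pi hs)]
  have h : ∀ x : Fin n → α, (Set.univ.pi s).indicator (fun x => ∏ i, f i (x i)) x =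
      ∏ i, (s i).indicator (f i) (x i) := by
    intro x
    by_cases hx : x ∈ Set.univ.pi s
    · rw [Set.indicator_of_mem hx]
      exact Finset.prod_congr rfl fun i _ => (Set.indicator_of_mem (hx i trivial) _).symm
    · rw [Set.indicator_of_notMem hx]
      simp only [Set.mem_pi, Set.mem_univ, true_imp_iff, not_forall] at hx
      obtain ⟨i, hi⟩ := hx
      exact (Finset.prod_eq_zero (Finset.mem_univ i) (Set.indicator_of_notMem hi _)).symm
  simp_rw [h]
  rw [lintegral_fin_prod_eq_prod _ _ fun i => (hf i).indicator (hs i)]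
  refine Finset.prod_congr rfl fun i _ => ?_
  rw [lintegral_indicator (hs i), withDensity_apply _ (hs i)]

/-- The Hellinger affinity of the measures with densities `p` and `q` with respect to `μ`. -/
def affinity (μ : Measure α) (p q : α → ℝ≥0∞) : ℝ≥0∞ :=
  ∫⁻ a, p a ^ (1 / 2 : ℝ) * q a ^ (1 / 2 : ℝ) ∂μ

theorem affinity_pi {n : ℕ} (μ : Measure α) [SigmaFinite μ] {p q : α → ℝ≥0∞}
    (hp : Measurable p) (hq : Measurable q) :
    affinity (Measure.pi fun _ : Fin n => μ) (fun x => ∏ i, p (x i)) (fun x => ∏ i, q (x i)) =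
      affinity μ p q ^ n := by
  have h : ∀ x : Fin n → α, (∏ i, p (x i)) ^ (1 / 2 : ℝ) * (∏ i, q (x i)) ^ (1 / 2 : ℝ) =
      ∏ i, (p (x i) ^ (1 / 2 : ℝ) * q (x i) ^ (1 / 2 : ℝ)) := by
    intro x
    rw [← ENNReal.prod_rpow_of_nonneg (by norm_num), ← ENNReal.prod_rpow_of_nonneg (by norm_num),
      Finset.prod_mul_distrib]
  unfold affinity
  simp_rw [h]
  rw [lintegral_fin_prod_eq_prod μ
    (fun _ a => p a ^ (1 / 2 : ℝ) * q a ^ (1 / 2 : ℝ)) fun i => by fun_prop]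
  simp

/-- Two-point lower bound for the quadratic risk in terms of the Hellinger affinity. -/
theorem two_point_bound (μ : Measure α) {p q : α → ℝ≥0∞} (hp : Measurable p) (hq : Measurable q)
    (hp1 : ∫⁻ a, p a ∂μ = 1) (hq1 : ∫⁻ a, q a ∂μ = 1) {g : α → ℝ} (hg : Measurable g)
    {ε : ℝ} (hε : 0 ≤ ε) :
    2 * (ENNReal.ofReal (ε ^ 2) * affinity μ p q ^ 2) ≤
      ∫⁻ a, ENNReal.ofReal ((g a - ε) ^ 2) ∂(μ.withDensity p) +
      ∫⁻ a, ENNReal.ofReal ((g a + ε) ^ 2) ∂(μ.withDensity q) := by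
  -- Cauchy–Schwarz: the error is paired with the root of one density, and the other density has
  -- mass one.
  have half : ∀ (c : ℝ) {f h : α → ℝ≥0∞}, Measurable f → Measurable h → ∫⁻ a, h a ∂μ = 1 →
      ∫⁻ a, (ENNReal.ofReal |g a + c| * f a ^ (1 / 2 : ℝ)) * h a ^ (1 / 2 : ℝ) ∂μ ≤
        (∫⁻ a, ENNReal.ofReal ((g a + c) ^ 2) ∂(μ.withDensity f)) ^ (1 / 2 : ℝ) := by
    intro c f h hf hh h1
    have := ENNReal.lintegral_mul_le_Lp_mul_Lq μ Real.HolderConjugate.two_two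
      (f := fun a => ENNReal.ofReal |g a + c| * f a ^ (1 / 2 : ℝ))
      (g := fun a => h a ^ (1 / 2 : ℝ)) (by fun_prop) (by fun_prop)
    refine this.trans (le_of_eq ?_)
    have e1 : ∫⁻ a, (h a ^ (1 / 2 : ℝ)) ^ (2 : ℝ) ∂μ = 1 := by
      rw [← h1]
      refine lintegral_congr fun a => ?_
      rw [← ENNReal.rpow_mul]; norm_num
    rw [e1, lintegral_withDensity_eq_lintegral_mul _ hf (by fun_prop)]
    simp only [ENNReal.one_rpow, mul_one]
    congr 1
    refine lintegral_congr fun a => ?_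
    rw [ENNReal.mul_rpow_of_nonneg _ _ (by norm_num), ← ENNReal.rpow_mul]
    norm_num
    rw [← ENNReal.ofReal_pow (abs_nonneg _), sq_abs, mul_comm]
  set A := ∫⁻ a, ENNReal.ofReal ((g a - ε) ^ 2) ∂(μ.withDensity p) with hA
  set B := ∫⁻ a, ENNReal.ofReal ((g a + ε) ^ 2) ∂(μ.withDensity q) with hB
  have key : ENNReal.ofReal (2 * ε) * affinity μ p q ≤ A ^ (1 / 2 : ℝ) + B ^ (1 / 2 : ℝ) := by
    have h1 := half (-ε) hp hq hq1
    have h2 := half ε hq hp hp1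
    simp only [← sub_eq_add_neg] at h1
    refine le_trans ?_ (add_le_add h1 h2)
    rw [affinity, ← lintegral_const_mul _ (by fun_prop), ← lintegral_add_left (by fun_prop)]
    refine lintegral_mono fun a => ?_
    have : ENNReal.ofReal (2 * ε) ≤ ENNReal.ofReal |g a - ε| + ENNReal.ofReal |g a + ε| := by
      rw [← ENNReal.ofReal_add (abs_nonneg _) (abs_nonneg _)]
      refine ENNReal.ofReal_le_ofReal ?_
      linarith [neg_abs_le (g a - ε), le_abs_self (g a + ε)]
    calc _ ≤ (ENNReal.ofReal |g a - ε| + ENNReal.ofReal |g a + ε|) *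
          (p a ^ (1 / 2 : ℝ) * q a ^ (1 / 2 : ℝ)) := by gcongr
      _ = _ := by ring
  have h4 : (ENNReal.ofReal (2 * ε) * affinity μ p q) ^ (2 : ℝ) ≤ 2 * (A + B) := by
    refine (ENNReal.rpow_le_rpow key (by norm_num)).trans ?_
    -- `(a + b) ^ 2 ≤ 2 (a ^ 2 + b ^ 2)`.
    refine (ENNReal.rpow_add_le_mul_rpow_add_rpow _ _ (by norm_num)).trans (le_of_eq ?_)
    rw [← ENNReal.rpow_mul, ← ENNReal.rpow_mul]
    norm_num
  have h5 : (ENNReal.ofReal (2 * ε) * affinity μ p q) ^ (2 : ℝ) =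
      2 * (2 * (ENNReal.ofReal (ε ^ 2) * affinity μ p q ^ 2)) := by
    rw [ENNReal.rpow_two, mul_pow, ENNReal.ofReal_mul (by norm_num), mul_pow,
      ENNReal.ofReal_pow hε]
    norm_num
    ring
  rw [h5] at h4
  exact (ENNReal.mul_le_mul_iff_right (by norm_num) (by norm_num)).1 h4

/-- Completing the square: the geometric mean of two Gaussian densities of equal variance is a
multiple of the one centred at the midpoint. -/
theorem affinity_gaussianPDF (a b : ℝ) {v : ℝ≥0} (hv : v ≠ 0) :
    affinity volume (gaussianPDF a v) (gaussianPDF b v) =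
      ENNReal.ofReal (Real.exp (-((a - b) ^ 2 / (8 * v)))) := by
  have hv' : (v : ℝ) ≠ 0 := by exact_mod_cast hv
  have h : ∀ y, gaussianPDF a v y ^ (1 / 2 : ℝ) * gaussianPDF b v y ^ (1 / 2 : ℝ) =
      ENNReal.ofReal (Real.exp (-((a - b) ^ 2 / (8 * v)))) * gaussianPDF ((a + b) / 2) v y := by
    intro y
    have hr : gaussianPDFReal a v y * gaussianPDFReal b v y =
        (Real.exp (-((a - b) ^ 2 / (8 * v))) * gaussianPDFReal ((a + b) / 2) v y) ^ 2 := by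
      simp only [gaussianPDFReal]
      have : ∀ c x y z w : ℝ, x + y = 2 * (z + w) →
          c * Real.exp x * (c * Real.exp y) = (Real.exp z * (c * Real.exp w)) ^ 2 := by
        intro c x y z w h
        calc _ = c ^ 2 * Real.exp (x + y) := by rw [Real.exp_add]; ring
          _ = c ^ 2 * Real.exp (z + w + (z + w)) := by rw [h]; ring_nf
          _ = _ := by rw [Real.exp_add, Real.exp_add]; ring
      apply this
      field_simp
      ring
    have h0 : 0 ≤ Real.exp (-((a - b) ^ 2 / (8 * v))) * gaussianPDFReal ((a + b) / 2) v y :=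
      mul_nonneg (Real.exp_nonneg _) (gaussianPDFReal_nonneg _ _ _)
    rw [← ENNReal.mul_rpow_of_nonneg _ _ (by norm_num)]
    simp only [gaussianPDF]
    rw [← ENNReal.ofReal_mul (gaussianPDFReal_nonneg _ _ _), hr,
      ENNReal.ofReal_rpow_of_nonneg (sq_nonneg _) (by norm_num), ← Real.sqrt_eq_rpow,
      Real.sqrt_sq h0, ENNReal.ofReal_mul (Real.exp_nonneg _)]
  unfold affinity
  simp_rw [h]
  rw [lintegral_const_mul _ (measurable_gaussianPDF _ _), lintegral_gaussianPDF_eq_one _ hv,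
    mul_one]

end Affinity

/-! ### The joint law of coefficients and observation -/

section Observation

variable {m p : ℕ}

theorem map_add_noiseLaw {σ : ℝ≥0} (hσ : 0 < σ) (a : Fin m → ℝ) :
    (noiseLaw m σ).map (fun n => a + n) =
      volume.withDensity fun y => ∏ j, gaussianPDF (a j) (σ ^ 2) (y j) := by
  have hv : σ ^ 2 ≠ 0 := (pow_pos hσ 2).ne'
  have h1 : (noiseLaw m σ).map (fun n => a + n) =
      Measure.pi fun j => gaussianReal (a j) (σ ^ 2) := by
    have := Measure.pi_map_pi (μ := fun _ : Fin m => gaussianReal 0 (σ ^ 2))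
      (f := fun j x => a j + x) (fun j => by fun_prop)
    simp only [gaussianReal_map_const_add, zero_add] at this
    exact this
  have hsf : ∀ j, SigmaFinite (volume.withDensity (gaussianPDF (a j) (σ ^ 2))) := fun j => by
    rw [← gaussianReal_of_var_ne_zero _ hv]; infer_instance
  rw [h1]
  simp_rw [gaussianReal_of_var_ne_zero _ hv]
  rw [pi_withDensity volume (fun j => gaussianPDF (a j) (σ ^ 2))
    fun j => measurable_gaussianPDF _ _]
  rfl

/-- The density of the joint law of `(x, y)`, where `y = D x + n`, with respect to the product of
the law of `x` and Lebesgue measure. -/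
def jointDensity (σ : ℝ≥0) (D : Matrix (Fin m) (Fin p) ℝ)
    (w : (Fin p → ℝ) × (Fin m → ℝ)) : ℝ≥0∞ :=
  ∏ j, gaussianPDF (D.mulVec w.1 j) (σ ^ 2) (w.2 j)

theorem measurable_mulVec (D : Matrix (Fin m) (Fin p) ℝ) :
    Measurable fun x : Fin p → ℝ => D.mulVec x :=
  (Continuous.matrix_mulVec continuous_const continuous_id).measurable

theorem measurable_jointDensity (σ : ℝ≥0) (D : Matrix (Fin m) (Fin p) ℝ) :
    Measurable (jointDensity σ D) := by
  refine Finset.measurable_prod _ fun j _ => ?_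
  have h1 : Measurable fun w : (Fin p → ℝ) × (Fin m → ℝ) => D.mulVec w.1 j :=
    (measurable_pi_apply j).comp ((measurable_mulVec D).comp measurable_fst)
  have h2 : Measurable fun w : (Fin p → ℝ) × (Fin m → ℝ) => w.2 j :=
    (measurable_pi_apply j).comp measurable_snd
  exact measurable_uncurry_gaussianPDF.comp (h1.prodMk (measurable_const.prodMk h2))

/-- Passing to pairs replaces the mixture density of `y` by an explicit product of Gaussian
densities. -/
theorem obsLaw_eq_map_snd (μx : Measure (Fin p → ℝ)) [IsProbabilityMeasure μx]
    {σ : ℝ≥0} (hσ : 0 < σ) (D : Matrix (Fin m) (Fin p) ℝ) :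
    obsLaw μx σ D = ((μx.prod volume).withDensity (jointDensity σ D)).map Prod.snd := by
  have hD := measurable_mulVec D
  have : IsProbabilityMeasure (noiseLaw m σ) := by unfold noiseLaw; infer_instance
  refine Measure.ext_of_lintegral _ fun f hf => ?_
  have hmeas : Measurable fun xn : (Fin p → ℝ) × (Fin m → ℝ) => D.mulVec xn.1 + xn.2 :=
    (hD.comp measurable_fst).add measurable_snd
  have hfs : Measurable fun w : (Fin p → ℝ) × (Fin m → ℝ) => f w.2 := hf.comp measurable_snd
  have hfa : Measurable fun w : (Fin p → ℝ) × (Fin m → ℝ) => f (D.mulVec w.1 + w.2) :=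
    hf.comp hmeas
  rw [obsLaw, lintegral_map hf hmeas, lintegral_map hf measurable_snd,
    lintegral_withDensity_eq_lintegral_mul _ (measurable_jointDensity σ D) hfs,
    lintegral_prod _ hfa.aemeasurable,
    lintegral_prod _ ((measurable_jointDensity σ D).mul hfs).aemeasurable]
  refine lintegral_congr fun x => ?_
  have hd : Measurable fun y : Fin m → ℝ => ∏ j, gaussianPDF (D.mulVec x j) (σ ^ 2) (y j) :=
    Finset.measurable_prod _ fun j _ => (measurable_gaussianPDF _ _).comp (measurable_pi_apply j)
  have h := lintegral_withDensity_eq_lintegral_mul volume hd hf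
  rw [← map_add_noiseLaw hσ, lintegral_map hf (by fun_prop)] at h
  exact h

theorem isProbabilityMeasure_obsLaw (μx : Measure (Fin p → ℝ)) [IsProbabilityMeasure μx]
    (σ : ℝ≥0) (D : Matrix (Fin m) (Fin p) ℝ) : IsProbabilityMeasure (obsLaw μx σ D) := by
  have : IsProbabilityMeasure (noiseLaw m σ) := by unfold noiseLaw; infer_instance
  exact Measure.isProbabilityMeasure_map
    (((measurable_mulVec D).comp measurable_fst).add measurable_snd).aemeasurable

theorem lintegral_jointDensity (μx : Measure (Fin p → ℝ)) [IsProbabilityMeasure μx]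
    {σ : ℝ≥0} (hσ : 0 < σ) (D : Matrix (Fin m) (Fin p) ℝ) :
    ∫⁻ w, jointDensity σ D w ∂(μx.prod volume) = 1 := by
  have := isProbabilityMeasure_obsLaw μx σ D
  have h := measure_univ (μ := obsLaw μx σ D)
  rwa [obsLaw_eq_map_snd μx hσ D, Measure.map_apply measurable_snd MeasurableSet.univ,
    Set.preimage_univ, withDensity_apply _ MeasurableSet.univ, Measure.restrict_univ] at h

theorem dataLaw_eq_map_snd (μx : Measure (Fin p → ℝ)) [IsProbabilityMeasure μx]
    {σ : ℝ≥0} (hσ : 0 < σ) (N : ℕ) (D : Matrix (Fin m) (Fin p) ℝ) :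
    dataLaw μx σ N D = ((Measure.pi fun _ : Fin N => μx.prod volume).withDensity
      fun w => ∏ i, jointDensity σ D (w i)).map fun w i => (w i).2 := by
  have hprob : IsProbabilityMeasure ((μx.prod volume).withDensity (jointDensity σ D)) :=
    ⟨by rw [withDensity_apply _ MeasurableSet.univ, Measure.restrict_univ,
      lintegral_jointDensity μx hσ D]⟩
  rw [← pi_withDensity (n := N) (μx.prod volume) (fun _ => jointDensity σ D)
    fun _ => measurable_jointDensity σ D, dataLaw]
  simp_rw [obsLaw_eq_map_snd μx hσ D]
  have : IsProbabilityMeasure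
      (((μx.prod volume).withDensity (jointDensity σ D)).map Prod.snd) :=
    Measure.isProbabilityMeasure_map measurable_snd.aemeasurable
  exact (Measure.pi_map_pi (fun _ => measurable_snd.aemeasurable)).symm

/-- Given `x`, the two densities are Gaussian products with means `D x` and `D' x`, so the affinity
factors over coordinates. -/
theorem affinity_jointDensity (μx : Measure (Fin p → ℝ)) [IsProbabilityMeasure μx]
    {σ : ℝ≥0} (hσ : 0 < σ) (D D' : Matrix (Fin m) (Fin p) ℝ) :
    affinity (μx.prod volume) (jointDensity σ D) (jointDensity σ D') =
      ∫⁻ x, ENNReal.ofReal (Real.exp (-(sqNorm ((D - D').mulVec x) / (8 * (σ : ℝ) ^ 2)))) ∂μx := by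
  have hv : σ ^ 2 ≠ 0 := (pow_pos hσ 2).ne'
  have h1 := measurable_jointDensity σ D
  have h2 := measurable_jointDensity σ D'
  rw [affinity, lintegral_prod _ (by fun_prop)]
  refine lintegral_congr fun x => ?_
  have h : ∀ y : Fin m → ℝ,
      jointDensity σ D (x, y) ^ (1 / 2 : ℝ) * jointDensity σ D' (x, y) ^ (1 / 2 : ℝ) =
      ∏ j, (gaussianPDF (D.mulVec x j) (σ ^ 2) (y j) ^ (1 / 2 : ℝ) *
        gaussianPDF (D'.mulVec x j) (σ ^ 2) (y j) ^ (1 / 2 : ℝ)) := by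
    intro y
    simp only [jointDensity]
    rw [← ENNReal.prod_rpow_of_nonneg (by norm_num), ← ENNReal.prod_rpow_of_nonneg (by norm_num),
      Finset.prod_mul_distrib]
  simp_rw [h]
  have h3 := lintegral_fin_prod_eq_prod (volume : Measure ℝ)
    (fun j t => gaussianPDF (D.mulVec x j) (σ ^ 2) t ^ (1 / 2 : ℝ) *
        gaussianPDF (D'.mulVec x j) (σ ^ 2) t ^ (1 / 2 : ℝ)) fun j =>
      ((measurable_gaussianPDF _ _).pow_const _).mul ((measurable_gaussianPDF _ _).pow_const _)
  rw [volume_pi, h3]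
  have h4 := fun j => affinity_gaussianPDF (D.mulVec x j) (D'.mulVec x j) hv
  unfold affinity at h4
  simp_rw [h4]
  rw [← ENNReal.ofReal_prod_of_nonneg fun _ _ => Real.exp_nonneg _, ← Real.exp_sum,
    Finset.sum_neg_distrib, ← Finset.sum_div]
  simp [sqNorm, Matrix.sub_mulVec]

end Observation

/-! ### Second moments and the signal-to-noise ratio -/

section Moments

variable {m p s : ℕ} {σa : ℝ} {μx : Measure (Fin p → ℝ)}

theorem measurableSet_supp_eq (S : Finset (Fin p)) : MeasurableSet {x : Fin p → ℝ | supp x = S} := by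
  have : {x : Fin p → ℝ | supp x = S} = ⋂ i, {x | x i ≠ 0 ↔ i ∈ S} := by
    ext x; simp [Finset.ext_iff, supp]
  rw [this]
  refine MeasurableSet.iInter fun i => ?_
  have h0 : MeasurableSet {x : Fin p → ℝ | x i = 0} :=
    measurableSet_eq_fun (measurable_pi_apply i) measurable_const
  by_cases hi : i ∈ S
  · simp only [hi, iff_true]
    exact h0.compl
  · simp only [hi, iff_false, not_not]
    exact h0

theorem IsSparseCoeffLaw.integrable_mul (h : IsSparseCoeffLaw s σa μx) (i j : Fin p) :
    Integrable (fun x : Fin p → ℝ => x i * x j) μx :=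
  (h.memLp_two i).integrable_mul (h.memLp_two j)

theorem IsSparseCoeffLaw.setIntegral_mul [IsProbabilityMeasure μx] (h : IsSparseCoeffLaw s σa μx)
    (hsp : s ≤ p) {S : Finset (Fin p)} (hS : S.card = s) (i j : Fin p) :
    ∫ x in {x | supp x = S}, x i * x j ∂μx =
      if i ∈ S ∧ i = j then 1 / (p.choose s : ℝ) * σa ^ 2 else 0 := by
  have hC : (0 : ℝ) < p.choose s := by exact_mod_cast Nat.choose_pos hsp
  by_cases hij : i ∈ S ∧ j ∈ S
  · have h1 := h.cond_cov S hS i hij.1 j hij.2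
    have h2 := h.supp_uniform S hS
    have h3 : (μx {x | supp x = S}).toReal = 1 / (p.choose s : ℝ) := h2
    rw [ProbabilityTheory.cond, integral_smul_measure, ENNReal.toReal_inv, h3] at h1
    simp only [one_div, inv_inv, smul_eq_mul] at h1
    have : ∫ x in {x | supp x = S}, x i * x j ∂μx =
        1 / (p.choose s : ℝ) * if i = j then σa ^ 2 else 0 := by
      rw [← h1]; field_simp
    rw [this]
    by_cases e : i = j <;> simp [e, hij.2]
  -- Outside `S × S` the integrand vanishes on the event.
  · have h0 : ∫ x in {x | supp x = S}, x i * x j ∂μx = 0 := by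
      refine setIntegral_eq_zero_of_forall_eq_zero fun x hx => ?_
      have hx' : supp x = S := hx
      rw [← hx'] at hij
      simp only [supp, Finset.mem_filter, Finset.mem_univ, true_and, not_and_or, not_not] at hij
      rcases hij with e | e <;> simp [e]
    rw [h0, if_neg]
    rintro ⟨h1, rfl⟩
    exact hij ⟨h1, h1⟩

/-- The second moment matrix of a sparse coefficient vector is `(s / p) σa² I`. -/
theorem IsSparseCoeffLaw.integral_mul [IsProbabilityMeasure μx] (h : IsSparseCoeffLaw s σa μx)
    (hs : 1 ≤ s) (hsp : s ≤ p) (i j : Fin p) :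
    ∫ x, x i * x j ∂μx = if i = j then (s : ℝ) / p * σa ^ 2 else 0 := by
  classical
  have hC : (0 : ℝ) < p.choose s := by exact_mod_cast Nat.choose_pos hsp
  set T := (Finset.univ : Finset (Fin p)).powersetCard s with hT
  have hTm : ∀ S, S ∈ T ↔ S.card = s := fun S => by simp [hT, Finset.mem_powersetCard]
  have hdisj : Set.PairwiseDisjoint (↑T : Set (Finset (Fin p)))
      fun S => {x : Fin p → ℝ | supp x = S} := by
    intro S _ S' _ hne
    refine Set.disjoint_left.2 fun x hx hx' => hne ?_
    exact Eq.trans (Eq.symm hx) hx'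
  -- The `p.choose s` equal probabilities already sum to one, so other supports are negligible.
  have hone : μx.real (⋃ S ∈ T, {x | supp x = S}) = 1 := by
    rw [measureReal_biUnion_finset hdisj fun S _ => measurableSet_supp_eq S,
      Finset.sum_congr rfl fun S hS => h.supp_uniform S ((hTm S).1 hS)]
    simp [hT, hC.ne']
  have hae : ∀ᵐ x ∂μx, x ∈ ⋃ S ∈ T, {x | supp x = S} := by
    refine (prob_compl_eq_zero_iff
      (T.measurableSet_biUnion fun S _ => measurableSet_supp_eq S)).2 ?_
    rw [← ENNReal.toReal_eq_one_iff]
    exact hone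
  rw [← setIntegral_eq_integral_of_ae_compl_eq_zero (s := ⋃ S ∈ T, {x | supp x = S})
    (hae.mono fun x hx hx' => absurd hx hx'),
    integral_biUnion_finset T (fun S _ => measurableSet_supp_eq S) hdisj
      fun S _ => (h.integrable_mul i j).integrableOn,
    Finset.sum_congr rfl fun S hS => h.setIntegral_mul hsp ((hTm S).1 hS) i j]
  by_cases e : i = j
  · subst e
    simp only [and_true, if_true]
    rw [← Finset.sum_filter, Finset.sum_const, nsmul_eq_mul]
    -- A fraction `s / p` of the `s`-subsets contains `i`.
    have hcard : (T.filter fun S => i ∈ S).card * p = p.choose s * s := by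
      have h1 := Finset.card_filter_powersetCard_subset {i} Finset.univ s (by simp) (by simpa)
      simp only [Finset.singleton_subset_iff, Finset.card_univ, Fintype.card_fin,
        Finset.card_singleton] at h1
      rw [hT, h1]
      obtain ⟨q, rfl⟩ : ∃ q, p = q + 1 := ⟨p - 1, by omega⟩
      obtain ⟨t, rfl⟩ : ∃ t, s = t + 1 := ⟨s - 1, by omega⟩
      rw [← Nat.add_one_mul_choose_eq]
      simp [mul_comm]
    have hp : (0 : ℝ) < p := by exact_mod_cast (by omega : 0 < p)
    have : ((T.filter fun S => i ∈ S).card : ℝ) * p = p.choose s * s := by exact_mod_cast hcard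
    field_simp
    linear_combination σa ^ 2 * this
  · simp [e]

theorem IsSparseCoeffLaw.integrable_sqNorm_mulVec (h : IsSparseCoeffLaw s σa μx)
    (A : Matrix (Fin m) (Fin p) ℝ) : Integrable (fun x => sqNorm (A.mulVec x)) μx := by
  simp only [sqNorm, Matrix.mulVec, dotProduct, sq, Finset.sum_mul_sum]
  refine integrable_finsetSum _ fun i _ => integrable_finsetSum _ fun k _ =>
    integrable_finsetSum _ fun l _ => ?_
  refine ((h.integrable_mul k l).const_mul (A i k * A i l)).congr (ae_of_all _ fun x => ?_)
  ring

theorem IsSparseCoeffLaw.integral_sqNorm_mulVec [IsProbabilityMeasure μx]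
    (h : IsSparseCoeffLaw s σa μx) (hs : 1 ≤ s) (hsp : s ≤ p) (A : Matrix (Fin m) (Fin p) ℝ) :
    ∫ x, sqNorm (A.mulVec x) ∂μx = (s : ℝ) / p * σa ^ 2 * ∑ i, ∑ k, A i k ^ 2 := by
  have hi : ∀ i k l, Integrable (fun x : Fin p → ℝ => A i k * x k * (A i l * x l)) μx :=
    fun i k l => ((h.integrable_mul k l).const_mul (A i k * A i l)).congr
      (ae_of_all _ fun x => by ring)
  simp only [sqNorm, Matrix.mulVec, dotProduct, sq, Finset.sum_mul_sum]
  rw [integral_finsetSum _ fun i _ => integrable_finsetSum _ fun k _ =>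
    integrable_finsetSum _ fun l _ => hi i k l, Finset.mul_sum]
  refine Finset.sum_congr rfl fun i _ => ?_
  rw [integral_finsetSum _ fun k _ => integrable_finsetSum _ fun l _ => hi i k l, Finset.mul_sum]
  refine Finset.sum_congr rfl fun k _ => ?_
  rw [integral_finsetSum _ fun l _ => hi i k l]
  have : ∀ l, ∫ x : Fin p → ℝ, A i k * x k * (A i l * x l) ∂μx =
      A i k * A i l * if k = l then (s : ℝ) / p * σa ^ 2 else 0 := by
    intro l
    rw [← h.integral_mul hs hsp k l, ← integral_const_mul]
    exact integral_congr_ae (ae_of_all _ fun x => by ring)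
  simp_rw [this]
  simp
  ring

theorem integral_sqNorm_noiseLaw (m : ℕ) (σ : ℝ≥0) :
    ∫ n, sqNorm n ∂(noiseLaw m σ) = m * (σ : ℝ) ^ 2 := by
  have h2 : ∫ t, t ^ 2 ∂(gaussianReal 0 (σ ^ 2)) = (σ : ℝ) ^ 2 := by
    have := variance_id_gaussianReal (μ := 0) (v := σ ^ 2)
    rw [variance_of_integral_eq_zero (by fun_prop) (by simp)] at this
    simpa using this
  have hint : Integrable (fun t : ℝ => t ^ 2) (gaussianReal 0 (σ ^ 2)) :=
    (memLp_id_gaussianReal 2).integrable_sq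
  simp only [sqNorm, noiseLaw]
  rw [integral_finsetSum _ fun i _ => integrable_comp_eval (μ := fun _ : Fin m =>
    gaussianReal 0 (σ ^ 2)) (i := i) hint]
  rw [Finset.sum_congr rfl fun i _ => (integral_comp_eval (μ := fun _ : Fin m =>
    gaussianReal 0 (σ ^ 2)) (i := i) hint.aestronglyMeasurable).trans h2]
  simp

theorem sum_sq_of_mem_dictionaries {D : Matrix (Fin m) (Fin p) ℝ} (hD : D ∈ dictionaries m p)
    (k : Fin p) : ∑ i, D i k ^ 2 = 1 := by
  have := hD k
  simpa [Matrix.mul_apply, sq] using this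

/-- Unit columns make the signal energy `s σa²`, the same for every dictionary. -/
theorem SNR_eq [IsProbabilityMeasure μx] (h : IsSparseCoeffLaw s σa μx) (hs : 1 ≤ s) (hsp : s ≤ p)
    (σ : ℝ≥0) {D : Matrix (Fin m) (Fin p) ℝ} (hD : D ∈ dictionaries m p) :
    SNR μx σ D = s * σa ^ 2 / (m * (σ : ℝ) ^ 2) := by
  have hp : (0 : ℝ) < p := by exact_mod_cast (by omega : 0 < p)
  rw [SNR, h.integral_sqNorm_mulVec hs hsp, integral_sqNorm_noiseLaw, Finset.sum_comm,
    Finset.sum_congr rfl fun k _ => sum_sq_of_mem_dictionaries hD k]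
  simp only [Finset.sum_const, Finset.card_univ, Fintype.card_fin, nsmul_eq_mul, mul_one]
  congr 1
  field_simp

end Moments

open scoped Matrix.Norms.Frobenius

/-! ### Two dictionaries: affinity and risk of the data laws -/

section TwoPoint

variable {m p s : ℕ} {σa : ℝ} {μx : Measure (Fin p → ℝ)}

theorem frobenius_norm_sq (A : Matrix (Fin m) (Fin p) ℝ) : ‖A‖ ^ 2 = ∑ i, ∑ k, A i k ^ 2 := by
  have h0 : 0 ≤ ∑ i, ∑ k, A i k ^ 2 :=
    Finset.sum_nonneg fun i _ => Finset.sum_nonneg fun k _ => sq_nonneg _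
  rw [Matrix.frobenius_norm_def]
  simp only [Real.rpow_two, Real.norm_eq_abs, sq_abs]
  rw [← Real.sqrt_eq_rpow, Real.sq_sqrt h0]

/-- Uses `1 - u ≤ exp (-u)` under the integral, so that only second moments of `x` matter. -/
theorem le_affinity_jointDensity [IsProbabilityMeasure μx] (h : IsSparseCoeffLaw s σa μx)
    (hs : 1 ≤ s) (hsp : s ≤ p) {σ : ℝ≥0} (hσ : 0 < σ) (D D' : Matrix (Fin m) (Fin p) ℝ) :
    ENNReal.ofReal (1 - (s : ℝ) / p * σa ^ 2 * ‖D - D'‖ ^ 2 / (8 * (σ : ℝ) ^ 2)) ≤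
      affinity (μx.prod volume) (jointDensity σ D) (jointDensity σ D') := by
  have hq := h.integrable_sqNorm_mulVec (D - D')
  have hq8 := hq.div_const (8 * (σ : ℝ) ^ 2)
  have hnn : ∀ x : Fin p → ℝ, 0 ≤ sqNorm ((D - D').mulVec x) / (8 * (σ : ℝ) ^ 2) := fun x =>
    div_nonneg (Finset.sum_nonneg fun i _ => sq_nonneg _) (by positivity)
  have hexp : Integrable
      (fun x => Real.exp (-(sqNorm ((D - D').mulVec x) / (8 * (σ : ℝ) ^ 2)))) μx := by
    refine (integrable_const (1 : ℝ)).mono'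
      (Real.continuous_exp.comp_aestronglyMeasurable hq8.neg.aestronglyMeasurable)
      (ae_of_all _ fun x => ?_)
    rw [Real.norm_eq_abs, abs_of_nonneg (Real.exp_nonneg _)]
    exact Real.exp_le_one_iff.2 (by linarith [hnn x])
  rw [affinity_jointDensity μx hσ, ← ofReal_integral_eq_lintegral_ofReal hexp
    (ae_of_all _ fun x => Real.exp_nonneg _)]
  refine ENNReal.ofReal_le_ofReal ?_
  have e : 1 - (s : ℝ) / p * σa ^ 2 * ‖D - D'‖ ^ 2 / (8 * (σ : ℝ) ^ 2) =
      ∫ x, (1 - sqNorm ((D - D').mulVec x) / (8 * (σ : ℝ) ^ 2)) ∂μx := by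
    rw [integral_sub (integrable_const _) hq8, integral_div, h.integral_sqNorm_mulVec hs hsp,
      frobenius_norm_sq]
    simp
  rw [e]
  refine integral_mono ((integrable_const _).sub hq8) hexp fun x => ?_
  have := Real.add_one_le_exp (-(sqNorm ((D - D').mulVec x) / (8 * (σ : ℝ) ^ 2)))
  simp only
  linarith

/-- The statistic is lifted to the `N` pairs `(x, y)`, where it ignores `x`; there the affinity
tensorizes. -/
theorem two_point_bound_dataLaw (μx : Measure (Fin p → ℝ)) [IsProbabilityMeasure μx]
    {σ : ℝ≥0} (hσ : 0 < σ) {N : ℕ} (D D' : Matrix (Fin m) (Fin p) ℝ)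
    {g : (Fin N → Fin m → ℝ) → ℝ} (hg : Measurable g) {ε : ℝ} (hε : 0 ≤ ε) :
    2 * (ENNReal.ofReal (ε ^ 2) *
        (affinity (μx.prod volume) (jointDensity σ D) (jointDensity σ D') ^ N) ^ 2) ≤
      ∫⁻ Y, ENNReal.ofReal ((g Y - ε) ^ 2) ∂(dataLaw μx σ N D) +
      ∫⁻ Y, ENNReal.ofReal ((g Y + ε) ^ 2) ∂(dataLaw μx σ N D') := by
  have hmeas : ∀ A : Matrix (Fin m) (Fin p) ℝ, Measurable
      fun w : Fin N → (Fin p → ℝ) × (Fin m → ℝ) => ∏ i, jointDensity σ A (w i) := fun A =>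
    Finset.measurable_prod _ fun i _ => (measurable_jointDensity σ A).comp (measurable_pi_apply i)
  have hone : ∀ A : Matrix (Fin m) (Fin p) ℝ,
      ∫⁻ w : Fin N → (Fin p → ℝ) × (Fin m → ℝ), ∏ i, jointDensity σ A (w i)
        ∂(Measure.pi fun _ => μx.prod volume) = 1 := fun A => by
    rw [lintegral_fin_prod_eq_prod (μx.prod volume) (fun _ => jointDensity σ A)
      fun _ => measurable_jointDensity σ A]
    simp [lintegral_jointDensity μx hσ A]
  have hobs : Measurable fun (w : Fin N → (Fin p → ℝ) × (Fin m → ℝ)) i => (w i).2 := by fun_prop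
  rw [dataLaw_eq_map_snd μx hσ N D, dataLaw_eq_map_snd μx hσ N D',
    lintegral_map (by fun_prop) hobs, lintegral_map (by fun_prop) hobs,
    ← affinity_pi (μx.prod volume) (measurable_jointDensity σ D) (measurable_jointDensity σ D')]
  exact two_point_bound _ (hmeas D) (hmeas D') (hone D) (hone D') (hg.comp hobs) hε

end TwoPoint

/-! ### The cube of perturbed dictionaries -/

section Hypercube

/-- The sign encoded by a Boolean. -/
def sgn (b : Bool) : ℝ := if b then 1 else -1

theorem sgn_sq (b : Bool) : sgn b ^ 2 = 1 := by cases b <;> simp [sgn]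

/-- Flipping the sign at `c` is an involution, so summing the pair bound over all `τ` counts each
value twice. -/
theorem card_mul_le_sum_of_update {ι : Type*} [Fintype ι] [DecidableEq ι]
    (F : (ι → Bool) → ℝ≥0∞) (c : ι) {L : ℝ≥0∞}
    (h : ∀ τ, 2 * L ≤ F (Function.update τ c true) + F (Function.update τ c false)) :
    Fintype.card (ι → Bool) * L ≤ ∑ τ, F τ := by
  let flip : (ι → Bool) → ι → Bool := fun τ => Function.update τ c (!τ c)
  have hflip : Function.Involutive flip := fun τ => by
    simp [flip]
  have h1 : ∑ τ, F (flip τ) = ∑ τ, F τ := Equiv.sum_comp hflip.toPerm F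
  have h2 : ∀ τ, 2 * L ≤ F τ + F (flip τ) := by
    intro τ
    have := h τ
    cases hc : τ c
    · rw [add_comm] at this
      have e : Function.update τ c false = τ := by rw [← hc]; exact Function.update_eq_self c τ
      simpa [flip, hc, e] using this
    · have e : Function.update τ c true = τ := by rw [← hc]; exact Function.update_eq_self c τ
      simpa [flip, hc, e] using this
  have h3 : 2 * (Fintype.card (ι → Bool) * L) ≤ 2 * ∑ τ, F τ := by
    calc 2 * (Fintype.card (ι → Bool) * L) = ∑ _τ : ι → Bool, 2 * L := by
          rw [Finset.sum_const, nsmul_eq_mul, Finset.card_univ]; ring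
      _ ≤ ∑ τ, (F τ + F (flip τ)) := Finset.sum_le_sum fun τ _ => h2 τ
      _ = 2 * ∑ τ, F τ := by rw [Finset.sum_add_distrib, h1, two_mul]
  exact (ENNReal.mul_le_mul_iff_right (by norm_num) (by norm_num)).1 h3

theorem sqNorm_mulVec_of_transpose_mul {n : ℕ} {U : Matrix (Fin n) (Fin n) ℝ}
    (hU : U.transpose * U = 1) (v : Fin n → ℝ) : sqNorm (U.mulVec v) = sqNorm v := by
  have h : ∀ w : Fin n → ℝ, sqNorm w = dotProduct w w := fun w => by
    simp [sqNorm, dotProduct, sq]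
  rw [h, h, Matrix.dotProduct_mulVec, ← Matrix.mulVec_transpose, Matrix.mulVec_mulVec, hU,
    Matrix.one_mulVec]

/-- A unit vector is the first row of an orthogonal matrix. -/
theorem exists_orthogonal_row_zero {n : ℕ} {u : Fin (n + 1) → ℝ} (hu : ∑ i, u i ^ 2 = 1) :
    ∃ U : Matrix (Fin (n + 1)) (Fin (n + 1)) ℝ,
      U * U.transpose = 1 ∧ ∀ i, U 0 i = u i := by
  have hon : Orthonormal ℝ (({0} : Set (Fin (n + 1))).domRestrict
      fun _ => (WithLp.toLp 2 u : EuclideanSpace ℝ (Fin (n + 1)))) := by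
    refine ⟨fun i => ?_, fun i j hij => absurd (Subsingleton.elim i j) hij⟩
    simp [EuclideanSpace.norm_eq, hu]
  obtain ⟨b, hb⟩ := hon.exists_orthonormalBasis_extension_of_card_eq (by simp)
  have h1 : (Matrix.of fun j i => b j i) * (Matrix.of fun j i => b j i).transpose = 1 := by
    ext j l
    have := orthonormal_iff_ite.1 b.orthonormal l j
    simp only [PiLp.inner_apply, RCLike.inner_apply, conj_trivial] at this
    simp [Matrix.mul_apply, Matrix.one_apply, this, eq_comm]
  refine ⟨Matrix.of fun j i => b j i, h1, fun i => ?_⟩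
  simp [hb 0 rfl]

variable {n p : ℕ}

/-- The squared Frobenius norm in terms of the coordinates of the columns in orthonormal bases. -/
theorem frobenius_norm_sq_eq_sum_mulVec {U : Fin p → Matrix (Fin n) (Fin n) ℝ}
    (hU : ∀ k, (U k).transpose * U k = 1) (A : Matrix (Fin n) (Fin p) ℝ) :
    ‖A‖ ^ 2 = ∑ k, sqNorm ((U k).mulVec fun i => A i k) := by
  rw [frobenius_norm_sq, Finset.sum_comm]
  exact Finset.sum_congr rfl fun k _ => (sqNorm_mulVec_of_transpose_mul (hU k) _).symm

/-- The coordinates of the columns of the perturbed dictionary with signs `τ`. -/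
def hypercubeCoord (ε : ℝ) (τ : Fin p × Fin n → Bool) (k : Fin p) : Fin (n + 1) → ℝ :=
  Fin.cons (Real.sqrt (1 - n * ε ^ 2)) fun j => ε * sgn (τ (k, j))

/-- The dictionary whose `k`-th column has the coordinates `hypercubeCoord ε τ k` in the
orthonormal basis formed by the rows of `U k`. -/
def hypercubeDict (U : Fin p → Matrix (Fin (n + 1)) (Fin (n + 1)) ℝ) (ε : ℝ)
    (τ : Fin p × Fin n → Bool) : Matrix (Fin (n + 1)) (Fin p) ℝ :=
  Matrix.of fun i k => (U k).transpose.mulVec (hypercubeCoord ε τ k) i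

variable {U : Fin p → Matrix (Fin (n + 1)) (Fin (n + 1)) ℝ} {ε : ℝ}

theorem mulVec_hypercubeDict (hU : ∀ k, U k * (U k).transpose = 1) (τ : Fin p × Fin n → Bool)
    (k : Fin p) : ((U k).mulVec fun i => hypercubeDict U ε τ i k) = hypercubeCoord ε τ k := by
  have : (fun i => hypercubeDict U ε τ i k) = (U k).transpose.mulVec (hypercubeCoord ε τ k) := rfl
  rw [this, Matrix.mulVec_mulVec, hU, Matrix.one_mulVec]

theorem hypercubeDict_mem_dictionaries (hU : ∀ k, U k * (U k).transpose = 1)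
    (hε : n * ε ^ 2 ≤ 1) (τ : Fin p × Fin n → Bool) :
    hypercubeDict U ε τ ∈ dictionaries (n + 1) p := by
  intro k
  have h : sqNorm (fun i => hypercubeDict U ε τ i k) = sqNorm (hypercubeCoord ε τ k) := by
    rw [← mulVec_hypercubeDict hU, sqNorm_mulVec_of_transpose_mul (mul_eq_one_comm.1 (hU k))]
  have h1 : sqNorm (hypercubeCoord ε τ k) = 1 := by
    simp [sqNorm, hypercubeCoord, Fin.sum_univ_succ, mul_pow, sgn_sq,
      Real.sq_sqrt (sub_nonneg.2 hε)]
  rw [h1] at h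
  simpa [Matrix.mul_apply, sqNorm, sq] using h

/-- Each column contributes `2 - 2 √(1 - n ε ^ 2)`, and `√a ≥ a` on `[0, 1]`. -/
theorem norm_hypercubeDict_sub_sq_le {D₀ : Matrix (Fin (n + 1)) (Fin p) ℝ}
    (hU : ∀ k, U k * (U k).transpose = 1) (hU0 : ∀ k i, U k 0 i = D₀ i k)
    (hε : n * ε ^ 2 ≤ 1) (τ : Fin p × Fin n → Bool) :
    ‖hypercubeDict U ε τ - D₀‖ ^ 2 ≤ 2 * (p * n) * ε ^ 2 := by
  rw [frobenius_norm_sq_eq_sum_mulVec fun k => mul_eq_one_comm.1 (hU k)]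
  have hD₀ : ∀ k, (U k).mulVec (fun i => D₀ i k) = Fin.cons 1 0 := by
    intro k
    ext j
    have h := congrFun (congrFun (hU k) j) 0
    simp only [Matrix.mul_apply, Matrix.transpose_apply, hU0] at h
    simp only [Matrix.mulVec, dotProduct, h]
    refine Fin.cases ?_ (fun j => ?_) j <;> simp
  have hk : ∀ k, sqNorm ((U k).mulVec fun i => (hypercubeDict U ε τ - D₀) i k) ≤
      2 * n * ε ^ 2 := by
    intro k
    have e : (fun i => (hypercubeDict U ε τ - D₀) i k) =
        (fun i => hypercubeDict U ε τ i k) - fun i => D₀ i k := rfl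
    rw [e, Matrix.mulVec_sub, mulVec_hypercubeDict hU, hD₀]
    simp only [sqNorm, hypercubeCoord, Fin.sum_univ_succ, Pi.sub_apply, Fin.cons_zero,
      Fin.cons_succ, Pi.zero_apply, sub_zero, mul_pow, sgn_sq, mul_one, Finset.sum_const,
      Finset.card_univ, Fintype.card_fin, nsmul_eq_mul]
    have h1 := Real.sq_sqrt (sub_nonneg.2 hε)
    have h2 := Real.sqrt_nonneg (1 - n * ε ^ 2)
    have h3 : Real.sqrt (1 - n * ε ^ 2) ≤ 1 := Real.sqrt_le_one.2 (by
      have : 0 ≤ n * ε ^ 2 := by positivity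
      linarith)
    nlinarith
  calc _ ≤ ∑ _k : Fin p, 2 * n * ε ^ 2 := Finset.sum_le_sum fun k _ => hk k
    _ = _ := by simp; ring

/-- The shrunken first coordinate does not depend on the signs, so only coordinate `c` moves, by `2
ε`. -/
theorem norm_hypercubeDict_update_sub_sq (hU : ∀ k, U k * (U k).transpose = 1)
    (τ : Fin p × Fin n → Bool) (c : Fin p × Fin n) :
    ‖hypercubeDict U ε (Function.update τ c true) -
      hypercubeDict U ε (Function.update τ c false)‖ ^ 2 = 4 * ε ^ 2 := by
  rw [frobenius_norm_sq_eq_sum_mulVec fun k => mul_eq_one_comm.1 (hU k)]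
  have hk : ∀ k, sqNorm ((U k).mulVec fun i => (hypercubeDict U ε (Function.update τ c true) -
      hypercubeDict U ε (Function.update τ c false)) i k) =
      ∑ j, if (k, j) = c then 4 * ε ^ 2 else 0 := by
    intro k
    have e : (fun i => (hypercubeDict U ε (Function.update τ c true) -
        hypercubeDict U ε (Function.update τ c false)) i k) =
        (fun i => hypercubeDict U ε (Function.update τ c true) i k) -
          fun i => hypercubeDict U ε (Function.update τ c false) i k := rfl
    rw [e, Matrix.mulVec_sub, mulVec_hypercubeDict hU, mulVec_hypercubeDict hU]
    simp only [sqNorm, hypercubeCoord, Fin.sum_univ_succ, Pi.sub_apply, Fin.cons_zero,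
      Fin.cons_succ, sub_self]
    rw [zero_pow two_ne_zero, zero_add]
    refine Finset.sum_congr rfl fun j _ => ?_
    by_cases h : (k, j) = c
    · simp [h, sgn]; ring
    · simp [h]
  rw [Finset.sum_congr rfl fun k _ => hk k, ← Fintype.sum_prod_type']
  simp

/-- Splits the loss into one scalar problem per sign by discarding the first coordinate of each
column. -/
theorem sum_sq_le_norm_sub_hypercubeDict_sq (hU : ∀ k, U k * (U k).transpose = 1)
    (τ : Fin p × Fin n → Bool) (A : Matrix (Fin (n + 1)) (Fin p) ℝ) :
    ∑ c : Fin p × Fin n, ((U c.1).mulVec (fun i => A i c.1) c.2.succ - ε * sgn (τ c)) ^ 2 ≤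
      ‖A - hypercubeDict U ε τ‖ ^ 2 := by
  rw [frobenius_norm_sq_eq_sum_mulVec (fun k => mul_eq_one_comm.1 (hU k)), Fintype.sum_prod_type]
  refine Finset.sum_le_sum fun k _ => ?_
  have e : (fun i => (A - hypercubeDict U ε τ) i k) =
      (fun i => A i k) - fun i => hypercubeDict U ε τ i k := rfl
  rw [e, Matrix.mulVec_sub, mulVec_hypercubeDict hU, sqNorm, Fin.sum_univ_succ]
  simp only [Pi.sub_apply, hypercubeCoord, Fin.cons_succ]
  exact le_add_of_nonneg_left (sq_nonneg _)

end Hypercube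

/-! ### Assouad's argument -/

section Assouad

variable {n p s N : ℕ} {σa : ℝ} {μx : Measure (Fin p → ℝ)}

/-- Assouad's lower bound for the minimax risk. -/
theorem le_minimaxRisk [IsProbabilityMeasure μx] (h : IsSparseCoeffLaw s σa μx)
    (hs : 1 ≤ s) (hsp : s ≤ p) (hN : 1 ≤ N) {σ : ℝ≥0} (hσ : 0 < σ)
    {D₀ : Matrix (Fin (n + 1)) (Fin p) ℝ} (hD₀ : D₀ ∈ dictionaries (n + 1) p)
    {r : ℝ} (hr : 0 < r) {ε : ℝ} (hε0 : 0 ≤ ε) (hε1 : n * ε ^ 2 ≤ 1)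
    (hεr : 2 * (p * n) * ε ^ 2 < r ^ 2)
    (hεN : N * ((s : ℝ) / p * σa ^ 2 * ε ^ 2 / (2 * (σ : ℝ) ^ 2)) ≤ 1 / 4) :
    ENNReal.ofReal (p * n * (ε ^ 2 / 2)) ≤ minimaxRisk μx σ N D₀ r := by
  choose U hU hU0 using fun k => exists_orthogonal_row_zero (sum_sq_of_mem_dictionaries hD₀ k)
  refine le_iInf₂ fun Dhat hDhat => ?_
  set R := ⨆ D ∈ neighborhood D₀ r, mse μx σ N Dhat D with hR
  let g : Fin p × Fin n → (Fin N → Fin (n + 1) → ℝ) → ℝ := fun c Y =>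
    (U c.1).mulVec (fun i => Dhat Y i c.1) c.2.succ
  have hg : ∀ c, Measurable (g c) := fun c => by
    simp only [g, Matrix.mulVec, dotProduct]
    exact Finset.measurable_sum _ fun i _ => (hDhat i c.1).const_mul _
  let F : Fin p × Fin n → (Fin p × Fin n → Bool) → ℝ≥0∞ := fun c τ =>
    ∫⁻ Y, ENNReal.ofReal ((g c Y - ε * sgn (τ c)) ^ 2) ∂(dataLaw μx σ N (hypercubeDict U ε τ))
  have hupper : ∀ τ, ∑ c, F c τ ≤ R := by
    intro τ
    have hmem : hypercubeDict U ε τ ∈ neighborhood D₀ r := by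
      refine ⟨hypercubeDict_mem_dictionaries hU hε1 τ, ?_⟩
      have h1 := norm_hypercubeDict_sub_sq_le hU hU0 hε1 τ
      exact lt_of_pow_lt_pow_left₀ 2 hr.le (h1.trans_lt hεr)
    refine le_trans ?_ (le_iSup₂ (f := fun D _ => mse μx σ N Dhat D) _ hmem)
    have hm : ∀ c, Measurable fun Y => ENNReal.ofReal ((g c Y - ε * sgn (τ c)) ^ 2) := fun c =>
      (((hg c).sub_const _).pow_const 2).ennreal_ofReal
    rw [← lintegral_finsetSum _ fun c _ => hm c, mse]
    refine lintegral_mono fun Y => ?_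
    rw [← ENNReal.ofReal_sum_of_nonneg fun c _ => sq_nonneg _]
    exact ENNReal.ofReal_le_ofReal (sum_sq_le_norm_sub_hypercubeDict_sq hU τ (Dhat Y))
  have hlower : ∀ c, Fintype.card (Fin p × Fin n → Bool) * ENNReal.ofReal (ε ^ 2 / 2) ≤
      ∑ τ, F c τ := by
    intro c
    refine card_mul_le_sum_of_update (F c) c fun τ => ?_
    have h1 := two_point_bound_dataLaw μx hσ (hypercubeDict U ε (Function.update τ c true))
      (hypercubeDict U ε (Function.update τ c false)) (hg c) hε0
    simp only [F, Function.update_self, sgn, if_true, Bool.false_eq_true, if_false, mul_one,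
      mul_neg, sub_neg_eq_add]
    refine le_trans ?_ h1
    refine mul_le_mul_right ?_ 2
    set ρ := affinity (μx.prod volume) (jointDensity σ (hypercubeDict U ε (Function.update τ c true)))
      (jointDensity σ (hypercubeDict U ε (Function.update τ c false)))
    set t := (s : ℝ) / p * σa ^ 2 * ε ^ 2 / (2 * (σ : ℝ) ^ 2) with ht
    have ht0 : 0 ≤ t := by positivity
    have hN' : (1 : ℝ) ≤ N := by exact_mod_cast hN
    have hρ : ENNReal.ofReal (1 - t) ≤ ρ := by
      refine le_trans (le_of_eq ?_) (le_affinity_jointDensity h hs hsp hσ _ _)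
      rw [norm_hypercubeDict_update_sub_sq hU]
      congr 2
      rw [ht]
      have : (σ : ℝ) ≠ 0 := by exact_mod_cast hσ.ne'
      field_simp
      ring
    have ht1 : t ≤ 1 / 4 := by nlinarith
    -- Bernoulli's inequality: `(1 - t) ^ N ≥ 1 - N t`.
    have hpow : (3 / 4 : ℝ) ≤ (1 - t) ^ N := by
      have := one_add_mul_le_pow (a := -t) (by linarith) N
      have e : 1 + -t = 1 - t := by ring
      rw [e] at this
      linarith
    have hρN : ENNReal.ofReal (3 / 4) ≤ ρ ^ N := by
      refine le_trans ?_ (pow_le_pow_left' hρ N)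
      rw [← ENNReal.ofReal_pow (by linarith)]
      exact ENNReal.ofReal_le_ofReal hpow
    -- `(3 / 4) ^ 2 = 9 / 16` exceeds `1 / 2`.
    calc ENNReal.ofReal (ε ^ 2 / 2) ≤ ENNReal.ofReal (ε ^ 2 * (3 / 4) ^ 2) :=
          ENNReal.ofReal_le_ofReal (by nlinarith [sq_nonneg ε])
      _ = ENNReal.ofReal (ε ^ 2) * ENNReal.ofReal (3 / 4) ^ 2 := by
          rw [ENNReal.ofReal_mul (sq_nonneg _), ENNReal.ofReal_pow (p := 3 / 4) (by norm_num)]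
      _ ≤ _ := by gcongr
  -- The worst-case risk dominates the average over the cube.
  have hcard : (Fintype.card (Fin p × Fin n → Bool) : ℝ≥0∞) * ENNReal.ofReal (p * n * (ε ^ 2 / 2)) ≤
      Fintype.card (Fin p × Fin n → Bool) * R := by
    calc _ = ∑ _c : Fin p × Fin n,
          Fintype.card (Fin p × Fin n → Bool) * ENNReal.ofReal (ε ^ 2 / 2) := by
          rw [Finset.sum_const, Finset.card_univ, Fintype.card_prod, Fintype.card_fin,
            Fintype.card_fin, nsmul_eq_mul, ENNReal.ofReal_mul (by positivity)]
          rw [← Nat.cast_mul, ENNReal.ofReal_natCast]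
          ring
      _ ≤ ∑ c, ∑ τ, F c τ := Finset.sum_le_sum fun c _ => hlower c
      _ = ∑ τ, ∑ c, F c τ := Finset.sum_comm
      _ ≤ ∑ _τ : Fin p × Fin n → Bool, R := Finset.sum_le_sum fun τ _ => hupper τ
      _ = _ := by rw [Finset.sum_const, nsmul_eq_mul, Finset.card_univ]
  refine (ENNReal.mul_le_mul_iff_right ?_ ?_).1 hcard
  · exact_mod_cast Fintype.card_ne_zero
  · exact ENNReal.natCast_ne_top _

end Assouad

end DictLearning

end

/-! ### Choice of the perturbation size -/

theorem corollary1 (m p s N : ℕ) (hmp : m ≤ p) (hs : 1 ≤ s) (hsp : s ≤ p) (hN : 1 ≤ N)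
    (σ : ℝ≥0) (hσ : 0 < σ) (σa : ℝ)
    (μx : Measure (Fin p → ℝ)) [IsProbabilityMeasure μx]
    (hμx : DictLearning.IsSparseCoeffLaw s σa μx)
    (D₀ : Matrix (Fin m) (Fin p) ℝ) (hD₀ : D₀ ∈ DictLearning.dictionaries m p)
    (r : ℝ) (hr : 0 < r) (hrp : r ≤ 2 * Real.sqrt p)
    (D : Matrix (Fin m) (Fin p) ℝ) (hD : D ∈ DictLearning.neighborhood D₀ r)
    (δ : ℝ) (hδ : δ ≤ 1 / 2) (hRIP : DictLearning.HasRIP D s δ)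
    (hdim : 50 ≤ (p : ℝ) * ((m : ℝ) - 1)) :
    (∀ i j, ∫ x, x i * x j ∂μx = if i = j then (s : ℝ) / p * σa ^ 2 else 0) ∧
    ENNReal.ofReal (1 / 320 * min (r ^ 2)
        (2 * (p : ℝ) / (DictLearning.SNR μx σ D * N * m) * ((p : ℝ) * ((m : ℝ) - 1) / 10 - 1)))
      ≤ DictLearning.minimaxRisk μx σ N D₀ r := by
  refine ⟨hμx.integral_mul hs hsp, ?_⟩
  rw [DictLearning.SNR_eq hμx hs hsp σ hD.1]
  have hp : (0 : ℝ) < p := by exact_mod_cast (by omega : 0 < p)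
  have hs' : (0 : ℝ) < s := by exact_mod_cast hs
  have hN' : (0 : ℝ) < N := by exact_mod_cast hN
  have hσ' : (0 : ℝ) < σ := by exact_mod_cast hσ
  obtain ⟨n, rfl⟩ : ∃ n, m = n + 1 := by
    refine ⟨m - 1, ?_⟩
    have : m ≠ 0 := by
      rintro rfl
      norm_num at hdim
      linarith
    omega
  have hm : ((n + 1 : ℕ) : ℝ) - 1 = n := by push_cast; ring
  have hm0 : (0 : ℝ) < ((n + 1 : ℕ) : ℝ) := by positivity
  rw [hm] at hdim ⊢
  -- Here the SNR is zero and division by zero returns `0`, so the claimed bound is `0`.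
  rcases eq_or_ne σa 0 with rfl | ha
  · simp [sq_nonneg]
  have hn : (0 : ℝ) < n := by
    by_contra hcon
    nlinarith [mul_nonpos_of_nonneg_of_nonpos hp.le (not_lt.1 hcon)]
  have ha2 : 0 < σa ^ 2 := by positivity
  set q : ℝ := (σ : ℝ) ^ 2 * p / (N * (s * σa ^ 2)) with hq
  have hq0 : 0 < q := by positivity
  have hK : 2 * (p : ℝ) / (s * σa ^ 2 / (((n + 1 : ℕ) : ℝ) * (σ : ℝ) ^ 2) * N * ((n + 1 : ℕ) : ℝ))
      = 2 * q := by
    rw [hq]; field_simp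
  rw [hK]
  -- `e` plays `ε ^ 2`. The first term keeps the cube in the neighborhood with a factor 2 to spare
  -- (hence strictly) and, by `r ^ 2 ≤ 4 p`, gives `n e ≤ 1`; the second makes `N t ≤ 1 / 8`.
  set e : ℝ := min (r ^ 2 / (4 * (p * n))) (q / 4) with he
  have he0 : 0 ≤ e := by positivity
  have he1 : e ≤ r ^ 2 / (4 * (p * n)) := min_le_left _ _
  have he2 : e ≤ q / 4 := min_le_right _ _
  have hd : (0 : ℝ) < p * n := by positivity
  have he1' : 4 * (p * n) * e ≤ r ^ 2 := by
    rw [le_div_iff₀ (by positivity)] at he1; linarith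
  have hr2 : r ^ 2 ≤ 4 * (p : ℝ) := by
    calc r ^ 2 ≤ (2 * Real.sqrt p) ^ 2 := by gcongr
      _ = 4 * (p : ℝ) := by rw [mul_pow, Real.sq_sqrt hp.le]; norm_num
  have hsq : Real.sqrt e ^ 2 = e := Real.sq_sqrt he0
  have hmain := DictLearning.le_minimaxRisk hμx hs hsp hN hσ hD₀ hr (ε := Real.sqrt e)
    (Real.sqrt_nonneg e) ?_ ?_ ?_
  · refine le_trans (ENNReal.ofReal_le_ofReal ?_) hmain
    rw [hsq]
    -- The risk bound is `r ^ 2 / 8` or `p n q / 8`, well above the claimed constants.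
    rcases min_cases (r ^ 2 / (4 * (p * n))) (q / 4) with ⟨h1, -⟩ | ⟨h1, -⟩
    · have h2 : (p * n : ℝ) * (e / 2) = r ^ 2 / 8 := by rw [he, h1]; field_simp; norm_num
      rw [h2]
      have := min_le_left (r ^ 2) (2 * q * (p * n / 10 - 1))
      nlinarith [sq_nonneg r]
    · have h2 : (p * n : ℝ) * (e / 2) = p * n * q / 8 := by rw [he, h1]; ring
      rw [h2]
      have := min_le_right (r ^ 2) (2 * q * (p * n / 10 - 1))
      nlinarith [mul_pos hd hq0]
  · rw [hsq]
    have : (p : ℝ) * (n * e) ≤ p * 1 := by linarith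
    exact le_of_mul_le_mul_left this hp
  · rw [hsq]
    nlinarith [pow_pos hr 2]
  · rw [hsq]
    calc (N : ℝ) * ((s : ℝ) / p * σa ^ 2 * e / (2 * (σ : ℝ) ^ 2))
        ≤ N * ((s : ℝ) / p * σa ^ 2 * (q / 4) / (2 * (σ : ℝ) ^ 2)) := by gcongr
      _ = 1 / 8 := by rw [hq]; field_simp; norm_num
      _ ≤ 1 / 4 := by norm_num
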